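/- **Setting.** Let $A$ be a set of actions containing a distinguished action $\surd$ (successful termination). A *signature* is a set of operators with ranks; *processes* are its closed terms, forming the set $\mathsf T$; $\Delta(\mathsf T)$ is the set of discrete probability distributions on $\mathsf T$, $\delta(t)$ is the Dirac distribution at $t$, $\theta\oplus_p\eta=p\,\theta+(1-p)\,\eta$, and $f(\pi_1,\dots,\pi_n)$ is the image of the product distribution under $(t_1,\dots,t_n)\mapsto f(t_1,\dots,t_n)$. A *PGSOS rule* derives a transition $f(x_1,\dots,x_n)\xrightarrow{a}\theta$ from finitely many premises $x_i\xrightarrow{b}\mu$ (with pairwise distinct distribution variables $\mu$) and $x_i\stackrel{b}{\nrightarrow}$ (no $b$-transition), where $\theta$ is built from these $x_i$ and $\mu$ by Dirac distributions of terms, convex combinations with positive weights and operators. A *specification* is a signature with a set of PGSOS rules, finitely many for each operator and label of the conclusion; its *supported model* is the unique relation ${\to}\subseteq\mathsf T\times A\times\Delta(\mathsf T)$ consisting exactly of the conclusions of those rule instances whose premises hold in it. A specification $P$ is a *disjoint extension* of $Q$ if it contains the operators and rules of $Q$ and has no other rules for the operators of $Q$. The process algebra $P_{\mathrm{PA}^\circlearrowleft}$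 has the following operators and rules, where $a\in A$ and $p\in(0,1)$ are arbitrary: * $0$: no rule; $\varepsilon\xrightarrow{\surd}\delta(0)$; $a.\bigoplus_{i=1}^n[p_i]x_i\xrightarrow{a}\sum_i p_i\delta(x_i)$ for $n\ge1$, $p_i\in(0,1]$, $\sum_ip_i=1$ (and $a.x$ stands for $a.([1]x)$); * $x;y\xrightarrow{a}\mu;\delta(y)$ if $x\xrightarrow{a}\mu$, $a\ne\surd$; $x;y\xrightarrow{a}\nu$ if $x\xrightarrow{\surd}\mu$, $y\xrightarrow{a}\nu$; * $x+y\xrightarrow{a}\mu$ if $x\xrightarrow{a}\mu$ or $y\xrightarrow{a}\mu$; $x+_py\xrightarrow{a}\mu\oplus_p\nu$ if $x\xrightarrow{a}\mu$, $y\xrightarrow{a}\nu$, and $x+_py\xrightarrow{a}\mu$ if one of $x,y$ has the transition $\xrightarrow{a}\mu$ and the other has no $a$-transition; * $x\mid y\xrightarrow{a}\mu\mid\nu$ if $x\xrightarrow{a}\mu$, $y\xrightarrow{a}\nu$, $a\neq\surd$; for each of the compositions $\mathbin{\circ}\in\{\mid,\;|||,\;|||_p,\;\parallel_B\}$: $x\circ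 y\xrightarrow{\surd}\delta(0)$ if $x\xrightarrow{\surd}\mu$, $y\xrightarrow{\surd}\nu$; * for $a\ne\surd$: $x\,|||\,y\xrightarrow{a}\mu\,|||\,\delta(y)$ if $x\xrightarrow{a}\mu$; $x\,|||\,y\xrightarrow{a}\delta(x)\,|||\,\nu$ if $y\xrightarrow{a}\nu$; $x\,|||_p\,y$ has these two rules (with $|||_p$ in the targets) with the extra premise that the other argument has no $a$-transition, and $x\,|||_p\,y\xrightarrow{a}(\mu\,|||_p\,\delta(y))\oplus_p(\delta(x)\,|||_p\,\nu)$ if $x\xrightarrow{a}\mu$, $y\xrightarrow{a}\nu$; for $B\subseteq A$, $x\parallel_By$ has (with $\parallel_B$ in the targets) the rules of $|||$ for $a\notin B$ and that of $\mid$ for $a\in B$; * $x^0\xrightarrow{\surd}\delta(0)$; $x^{n+1}\xrightarrow{\surd}\mu$ if $x\xrightarrow{\surd}\mu$; for $a\ne\surd$: $x^{n+1}\xrightarrow{a}\mu;\delta(x^n)$ if $x\xrightarrow{a}\mu$, and $x^n\xrightarrow{a}\nu;\delta(x^m)$ if $m<n$, $x\xrightarrow{\surd}\mu$, $x\xrightarrow{a}\nu$;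 * infinite iteration: $x^\omega\xrightarrow{a}\mu;\delta(x^\omega)$ if $x\xrightarrow{a}\mu$, $a\neq\surd$; * Kleene star: $x^*y\xrightarrow{a}\mu;\delta(x^*y)$ if $x\xrightarrow{a}\mu$, $a\ne\surd$; $x^*y\xrightarrow{a}\nu$ if $y\xrightarrow{a}\nu$; * probabilistic Kleene star, for $a\neq\surd$: $x^{*_p}y\xrightarrow{a}\nu\oplus_p(\mu;\delta(x^{*_p}y))$ if $x\xrightarrow{a}\mu$, $y\xrightarrow{a}\nu$; $x^{*_p}y\xrightarrow{a}\mu;\delta(x^{*_p}y)$ if $x\xrightarrow{a}\mu$, $y\stackrel{a}{\nrightarrow}$; $x^{*_p}y\xrightarrow{a}\nu$ if $x\stackrel{a}{\nrightarrow}$, $y\xrightarrow{a}\nu$; and $x^{*_p}y\xrightarrow{\surd}\nu$ if $y\xrightarrow{\surd}\nu$; * $!^0x\xrightarrow{\surd}\delta(0)$; $!^{n+1}x\xrightarrow{\surd}\mu$ if $x\xrightarrow{\surd}\mu$; $!^{n+1}x\xrightarrow{a}\mu\,|||\,\delta(!^nx)$ if $x\xrightarrow{a}\mu$, $a\ne\surd$;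 * bang: $!x\xrightarrow{a}\mu\,|||\,\delta(!x)$ if $x\xrightarrow{a}\mu$, $a\neq\surd$; probabilistic bang: $!_px\xrightarrow{a}\mu\oplus_p(\mu\,|||\,\delta(!_px))$ if $x\xrightarrow{a}\mu$, $a\ne\surd$. A pseudometric $d:\mathsf T\times\mathsf T\to[0,1]$ is a *non-discounted bisimulation metric* if, whenever $d(t,t')<1$ and $t\xrightarrow{a}\pi$, there is $t'\xrightarrow{a}\pi'$ with $\mathbf K(d)(\pi,\pi')\le d(t,t')$, where $\mathbf K(d)(\pi,\pi')=\min_\omega\sum_{u,u'}d(u,u')\,\omega(u,u')$ over all distributions $\omega$ on $\mathsf T\times\mathsf T$ with marginals $\pi,\pi'$. The *non-discounted bisimilarity metric* $\mathbf d$ (discount factor $\lambda=1$) is the smallest one, i.e. the pointwise infimum of all of them. An $n$-ary operator $f$ is *uniformly continuous* w.r.t. $\mathbf d$ if for every $\epsilon>0$ there are $\delta_1,\dots,\delta_n>0$ such that for all processes $s_i,t_i$: if $\mathbf d(s_i,t_i)<\delta_i$ for all $i$, then $\mathbf d(f(s_1,\dots,s_n),f(t_1,\dots,t_n))<\epsilon$.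 **Proposition.** Let $P$ be any disjoint extension of $P_{\mathrm{PA}^\circlearrowleft}$, let $\mathbf d$ be the non-discounted bisimilarity metric of its supported model, and let $a\in A$ with $a\neq\surd$. 1. None of infinite iteration $\_^\omega$, Kleene star $\_^*\_$ and probabilistic Kleene star $\_^{*_p}\_$ (for any $p\in(0,1)$) is uniformly continuous w.r.t. $\mathbf d$. 2. If $A$ contains a further action $b\notin\{a,\surd\}$, then bang $!\_$ is not uniformly continuous w.r.t. $\mathbf d$. 3. For every $\delta\in(0,2)$, the processes $s=a.([1-\delta/2]\varepsilon\oplus[\delta/2]0)$ and $t=a.\varepsilon$ satisfy $\mathbf d(s,t)=\delta/2$ and $\mathbf d(s^\omega,t^\omega)=1$. -/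

import Mathlib

namespace ProbProc

universe u v w

/-! ### Signatures, terms, distributions -/

/-- A signature: `Op n` is the set of operators of rank `n`. -/
structure Signature where
  Op : ℕ → Type u

/-- State terms over the signature `S` and the set `V` of state variables. -/
inductive Term (S : Signature.{u}) (V : Type) : Type u
  | var (x : V) : Term S V
  | op {n : ℕ} (f : S.Op n) (ts : Fin n → Term S V) : Term S V

/-- Closed state terms, i.e. processes. -/
abbrev Proc (S : Signature.{u}) : Type u := Term S Empty

/-- Substitution of state terms for state variables. -/
def Term.subst {S : Signature.{u}} {V W : Type} (σ : V → Term S W) : Term S V → Term S W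
  | .var x => σ x
  | .op f ts => .op f (fun i => (ts i).subst σ)

/-- Distribution terms over `S`, state variables `Vs` and distribution variables `Vd`:
distribution variables, instantiable Dirac distributions, convex combinations (with positive
weights, so that the index set is countable) and lifted operators. -/
inductive DTerm (S : Signature.{u}) (Vs Vd : Type) : Type (max u 1)
  | var (μ : Vd) : DTerm S Vs Vd
  | dirac (t : Term S Vs) : DTerm S Vs Vd
  | convex (I : Type) (p : PMF I) (hp : ∀ i, p i ≠ 0) (θ : I → DTerm S Vs Vd) : DTerm S Vs Vd
  | op {n : ℕ} (f : S.Op n) (θ : Fin n → DTerm S Vs Vd) : DTerm S Vs Vd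

/-- The product of finitely many probability distributions. -/
noncomputable def prodPMF {α : Type u} : (n : ℕ) → (Fin n → PMF α) → PMF (Fin n → α)
  | 0, _ => PMF.pure Fin.elim0
  | n + 1, π => (π 0).bind fun x => (prodPMF n (fun i => π i.succ)).map (Fin.cons x)

theorem prodPMF_apply {α : Type u} : (n : ℕ) → (π : Fin n → PMF α) → (x : Fin n → α) →
    prodPMF n π x = ∏ i, π i (x i)
  | 0, π, x => by
    have : x = Fin.elim0 := Subsingleton.elim _ _
    simp [prodPMF, this]
  | n + 1, π, x => by
    classical
    rw [prodPMF, PMF.bind_apply, tsum_eq_single (x 0), Fin.prod_univ_succ]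
    · congr 1
      rw [PMF.map_apply, tsum_eq_single (Fin.tail x), if_pos (Fin.cons_self_tail x).symm,
        prodPMF_apply n]
      · rfl
      · intro y hy
        rw [if_neg]
        rintro h
        exact hy (by rw [h, Fin.tail_cons])
    · intro y hy
      rw [PMF.map_apply]
      simp only [mul_eq_zero, ENNReal.tsum_eq_zero]
      right
      intro z
      rw [if_neg]
      intro h
      exact hy (by rw [h, Fin.cons_zero])

/-- The value of a distribution term when its state variables are replaced by the processes `σ`
and its distribution variables take the values `ρ`. In the last case this is the product
distribution, which gives mass `∏ i, πᵢ(tᵢ)` to `f(t₁,…,tₙ)` and no mass to other terms. -/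
noncomputable def DTerm.eval {S : Signature.{u}} {Vs Vd : Type} (σ : Vs → Proc S)
    (ρ : Vd → PMF (Proc S)) : DTerm S Vs Vd → PMF (Proc S)
  | .var μ => ρ μ
  | .dirac t => PMF.pure (t.subst σ)
  | .convex _ p _ θ => p.bind fun i => (θ i).eval σ ρ
  | .op (n := n) f θ => (prodPMF n (fun i => (θ i).eval σ ρ)).map (Term.op f)

/-! ### Probabilistic transition systems and bisimilarity metrics -/

/-- A probabilistic transition system with the processes over `S` as states. -/
structure PTS (S : Signature.{u}) (A : Type v) where
  trans : Proc S → A → PMF (Proc S) → Prop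

/-- `ω` is a matching for `(π, π')`: its marginals are `π` and `π'`. -/
def IsMatching {T : Type u} (π π' : PMF T) (ω : PMF (T × T)) : Prop :=
  ω.map Prod.fst = π ∧ ω.map Prod.snd = π'

/-- The Kantorovich lifting of a (1-bounded) pseudometric `d`. -/
noncomputable def kantorovich {T : Type u} (d : T → T → ℝ) (π π' : PMF T) : ℝ :=
  ⨅ ω : {ω : PMF (T × T) // IsMatching π π' ω}, ∑' x : T × T, d x.1 x.2 * (ω.1 x).toReal

/-- 1-bounded pseudometrics. -/
structure IsBoundedPseudometric {T : Type u} (d : T → T → ℝ) : Prop where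
  nonneg : ∀ s t, 0 ≤ d s t
  le_one : ∀ s t, d s t ≤ 1
  self : ∀ t, d t t = 0
  symm : ∀ s t, d s t = d t s
  triangle : ∀ s t u, d s u ≤ d s t + d t u

/-- `d` is a bisimulation metric with discount factor `lam`. -/
structure IsBisimMetric {S : Signature.{u}} {A : Type v} (M : PTS S A) (lam : ℝ)
    (d : Proc S → Proc S → ℝ) : Prop extends IsBoundedPseudometric d where
  transfer : ∀ t t', d t t' < 1 → ∀ a π, M.trans t a π →
    ∃ π', M.trans t' a π' ∧ lam * kantorovich d π π' ≤ d t t'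

/-- The bisimilarity metric with discount factor `lam`: the smallest bisimulation metric, given
as the pointwise infimum of all bisimulation metrics. -/
noncomputable def bisimDist {S : Signature.{u}} {A : Type v} (M : PTS S A) (lam : ℝ)
    (s t : Proc S) : ℝ :=
  ⨅ d : {d : Proc S → Proc S → ℝ // IsBisimMetric M lam d}, d.1 s t

/-- An operator `f` of rank `n` is uniformly continuous with respect to the distance `d`. -/
def IsUnifContOp {S : Signature.{u}} (d : Proc S → Proc S → ℝ) {n : ℕ} (f : S.Op n) : Prop :=
  ∀ ε : ℝ, 0 < ε → ∃ δ : Fin n → ℝ, (∀ i, 0 < δ i) ∧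
    ∀ s t : Fin n → Proc S, (∀ i, d (s i) (t i) < δ i) → d (.op f s) (.op f t) < ε

/-! ### PGSOS specifications -/

/-- A PGSOS rule for an operator of rank `n`, up to the names of variables, and without the
operator and the action of its conclusion. The source variables are `x_i` for `i : Fin n`. The
`k`-th positive premise is `x_i --b--> μ_k` with `(i, b) = pos k`, and `(i, b) ∈ neg` stands for
the negative premise that `x_i` has no `b`-labelled transition. -/
structure Rule (S : Signature.{u}) (A : Type v) (n : ℕ) where
  numPos : ℕ
  pos : Fin numPos → Fin n × A
  neg : List (Fin n × A)
  target : DTerm S (Fin n) (Fin numPos)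

/-- A probabilistic transition system specification over `S` and `A` in PGSOS format:
`rules f a` are the rules with source operator `f` and an `a`-labelled conclusion. -/
structure PTSS (S : Signature.{u}) (A : Type v) where
  rules : ∀ {n : ℕ}, S.Op n → A → Set (Rule S A n)
  finite_rules : ∀ {n : ℕ} (f : S.Op n) (a : A), (rules f a).Finite

/-- The instance of the rule `r` given by `σ` and `ρ` has all its premises satisfied in `M`. -/
def Rule.Premises {S : Signature.{u}} {A : Type v} {n : ℕ} (r : Rule S A n) (M : PTS S A)
    (σ : Fin n → Proc S) (ρ : Fin r.numPos → PMF (Proc S)) : Prop :=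
  (∀ k, M.trans (σ (r.pos k).1) (r.pos k).2 (ρ k)) ∧
    ∀ q ∈ r.neg, ∀ π, ¬ M.trans (σ q.1) q.2 π

/-- `M` is a supported model of `P`: its transitions are exactly those that are the conclusion of
an instance of a rule of `P` whose premises hold in `M`. -/
def PTSS.IsSupportedModel {S : Signature.{u}} {A : Type v} (P : PTSS S A) (M : PTS S A) : Prop :=
  ∀ t a π, M.trans t a π ↔ ∃ (n : ℕ) (f : S.Op n) (r : Rule S A n) (σ : Fin n → Proc S)
    (ρ : Fin r.numPos → PMF (Proc S)), r ∈ P.rules f a ∧ r.Premises M σ ρ ∧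
      t = .op f σ ∧ π = r.target.eval σ ρ

/-- The transitions derived from `P` by structural recursion on the source. -/
def PTSS.derive {S : Signature.{u}} {A : Type v} (P : PTSS S A) :
    Proc S → A → PMF (Proc S) → Prop
  | .op f ts => fun a π => ∃ r ∈ P.rules f a, ∃ ρ : Fin r.numPos → PMF (Proc S),
      (∀ k, P.derive (ts (r.pos k).1) (r.pos k).2 (ρ k)) ∧
      (∀ q ∈ r.neg, ∀ π', ¬ P.derive (ts q.1) q.2 π') ∧ π = r.target.eval ts ρ

/-- Every specification has a supported model. -/
theorem PTSS.exists_isSupportedModel {S : Signature.{u}} {A : Type v} (P : PTSS S A) :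
    ∃ M, P.IsSupportedModel M := by
  refine ⟨⟨P.derive⟩, ?_⟩
  intro t a π
  constructor
  · intro h
    match t, h with
    | .op f ts, h =>
      simp only [PTSS.derive] at h
      obtain ⟨r, hr, ρ, h1, h2, h3⟩ := h
      exact ⟨_, f, r, ts, ρ, hr, ⟨h1, h2⟩, rfl, h3⟩
  · rintro ⟨n, f, r, σ, ρ, hr, ⟨h1, h2⟩, rfl, h3⟩
    simp only [PTSS.derive]
    exact ⟨r, hr, ρ, h1, h2, h3⟩

/-- The supported model is unique. -/
theorem PTSS.isSupportedModel_unique {S : Signature.{u}} {A : Type v} (P : PTSS S A)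
    {M N : PTS S A} (hM : P.IsSupportedModel M) (hN : P.IsSupportedModel N) : M = N := by
  have key : ∀ t a π, M.trans t a π ↔ N.trans t a π := by
    intro t
    induction t with
    | var x => exact x.elim
    | op f ts ih =>
      intro a π
      rw [hM, hN]
      constructor <;>
      · rintro ⟨n, g, r, σ, ρ, hr, ⟨h1, h2⟩, h3, h4⟩
        cases h3
        refine ⟨_, _, r, _, ρ, hr, ⟨fun k => ?_, fun q hq π' h => h2 q hq π' ?_⟩, rfl, h4⟩
        · simpa [ih] using h1 k
        · simpa [ih] using h
  cases M
  cases N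
  congr
  funext t a π
  exact propext (key t a π)

/-! ### Disjoint extensions -/

/-- Translation of state terms along a map of operators. -/
def Term.mapOp {S : Signature.{u}} {S' : Signature.{w}} (ι : ∀ {n : ℕ}, S.Op n → S'.Op n)
    {V : Type} : Term S V → Term S' V
  | .var x => .var x
  | .op f ts => .op (ι f) (fun i => (ts i).mapOp ι)

/-- Translation of distribution terms along a map of operators. -/
def DTerm.mapOp {S : Signature.{u}} {S' : Signature.{w}} (ι : ∀ {n : ℕ}, S.Op n → S'.Op n)
    {Vs Vd : Type} : DTerm S Vs Vd → DTerm S' Vs Vd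
  | .var μ => .var μ
  | .dirac t => .dirac (t.mapOp ι)
  | .convex I p hp θ => .convex I p hp (fun i => (θ i).mapOp ι)
  | .op f θ => .op (ι f) (fun i => (θ i).mapOp ι)

/-- Translation of rules along a map of operators. -/
def Rule.mapOp {S : Signature.{u}} {S' : Signature.{w}} (ι : ∀ {n : ℕ}, S.Op n → S'.Op n)
    {A : Type v} {n : ℕ} (r : Rule S A n) : Rule S' A n where
  numPos := r.numPos
  pos := r.pos
  neg := r.neg
  target := r.target.mapOp ι

/-- `Q` is a disjoint extension of `P`: the operators of `P` are operators of `Q` (through the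
injection `ι`), and the rules of `Q` for these operators are exactly the rules of `P`. -/
structure DisjointExtension {S : Signature.{u}} {S' : Signature.{w}} {A : Type v}
    (P : PTSS S A) (Q : PTSS S' A) where
  ι : ∀ {n : ℕ}, S.Op n → S'.Op n
  injective : ∀ n : ℕ, Function.Injective (ι (n := n))
  rules_eq : ∀ {n : ℕ} (f : S.Op n) (a : A),
    Q.rules (ι f) a = Rule.mapOp (fun {_} g => ι g) '' P.rules f a

/-! ### The process algebra with recursive combinators -/

/-- Probabilities `p` with `0 < p < 1`. -/
abbrev Prob : Type := Set.Ioo (0 : ℝ) 1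

/-- The weights `p, 1 - p`. -/
noncomputable def Prob.weights (p : Prob) : PMF (Fin 2) :=
  PMF.ofFintype ![ENNReal.ofReal p.1, ENNReal.ofReal (1 - p.1)] (by
    have h0 := p.2.1
    have h1 := p.2.2
    rw [Fin.sum_univ_two]
    simp only [Matrix.cons_val_zero, Matrix.cons_val_one]
    rw [← ENNReal.ofReal_add h0.le (by linarith)]
    simp)

theorem Prob.weights_ne_zero (p : Prob) (i : Fin 2) : p.weights i ≠ 0 := by
  have h0 := p.2.1
  have h1 := p.2.2
  fin_cases i
  · simpa [Prob.weights] using h0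
  · simpa [Prob.weights] using h1

/-- The operators of the process algebra over the set `A` of actions, by rank. -/
inductive PAOp (A : Type v) : ℕ → Type v
  /-- the stop process `0` -/
  | nil : PAOp A 0
  /-- the skip process `ε` -/
  | skip : PAOp A 0
  /-- probabilistic action prefixing `a.([p₁]_ ⊕ … ⊕ [pₙ]_)` with positive weights -/
  | act (a : A) {n : ℕ} (p : PMF (Fin n)) (hp : ∀ i, p i ≠ 0) : PAOp A n
  /-- sequential composition `x ; y` -/
  | seq : PAOp A 2
  /-- alternative composition `x + y` -/
  | alt : PAOp A 2
  /-- probabilistic alternative composition `x +_p y` -/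
  | palt (p : Prob) : PAOp A 2
  /-- synchronous parallel composition `x | y` -/
  | sync : PAOp A 2
  /-- asynchronous parallel composition `x ||| y` -/
  | async : PAOp A 2
  /-- probabilistic parallel composition `x |||_p y` -/
  | pasync (p : Prob) : PAOp A 2
  /-- CSP-like parallel composition `x ‖_B y` -/
  | csp (B : Set A) : PAOp A 2
  /-- finite iteration `x^n` -/
  | iter (n : ℕ) : PAOp A 1
  /-- infinite iteration `x^ω` -/
  | omega : PAOp A 1
  /-- binary Kleene star `x^* y` -/
  | kleene : PAOp A 2
  /-- probabilistic Kleene star `x^{*_p} y` -/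
  | pkleene (p : Prob) : PAOp A 2
  /-- finite replication `!^n x` -/
  | repl (n : ℕ) : PAOp A 1
  /-- infinite replication (bang) `! x` -/
  | bang : PAOp A 1
  /-- probabilistic bang `!_p x` -/
  | pbang (p : Prob) : PAOp A 1

/-- The signature of the process algebra. -/
abbrev PASig (A : Type v) : Signature.{v} := ⟨PAOp A⟩

section Rules

variable {A : Type v}

/-- Application of a unary operator to a state term. -/
def t1 {V : Type} (f : PAOp A 1) (x : Term (PASig A) V) : Term (PASig A) V :=
  .op (S := PASig A) f ![x]

/-- Application of a binary operator to state terms. -/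
def t2 {V : Type} (f : PAOp A 2) (x y : Term (PASig A) V) : Term (PASig A) V :=
  .op (S := PASig A) f ![x, y]

/-- Application of a binary operator to distribution terms. -/
def d2 {Vs Vd : Type} (f : PAOp A 2) (θ η : DTerm (PASig A) Vs Vd) : DTerm (PASig A) Vs Vd :=
  .op (S := PASig A) f ![θ, η]

/-- The Dirac distribution at the stop process. -/
def dnil {Vs Vd : Type} : DTerm (PASig A) Vs Vd :=
  .dirac (.op (S := PASig A) PAOp.nil ![])

/-- The distribution term `θ ⊕_p η`. -/
noncomputable def mix {Vs Vd : Type} (p : Prob) (θ η : DTerm (PASig A) Vs Vd) :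
    DTerm (PASig A) Vs Vd :=
  .convex (Fin 2) p.weights p.weights_ne_zero ![θ, η]

/-- A rule without premises. -/
def rule0 {n : ℕ} (θ : DTerm (PASig A) (Fin n) (Fin 0)) : Rule (PASig A) A n :=
  ⟨0, ![], [], θ⟩

/-- A rule with the positive premise `x_i --b--> μ₀` and the negative premises `neg`. -/
def rule1 {n : ℕ} (i : Fin n) (b : A) (neg : List (Fin n × A))
    (θ : DTerm (PASig A) (Fin n) (Fin 1)) : Rule (PASig A) A n :=
  ⟨1, ![(i, b)], neg, θ⟩

/-- A rule with the positive premises `x_i --b--> μ₀` and `x_j --c--> μ₁`. -/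
def rule2 {n : ℕ} (i : Fin n) (b : A) (j : Fin n) (c : A)
    (θ : DTerm (PASig A) (Fin n) (Fin 2)) : Rule (PASig A) A n :=
  ⟨2, ![(i, b), (j, c)], [], θ⟩

/-- `rulesIf c r` consists of the rule `r` if the side condition `c` holds, and is empty
otherwise. -/
def rulesIf {n : ℕ} (c : Prop) (r : Rule (PASig A) A n) : Set (Rule (PASig A) A n) :=
  {r' | c ∧ r' = r}

theorem rulesIf_finite {n : ℕ} (c : Prop) (r : Rule (PASig A) A n) : (rulesIf c r).Finite :=
  (Set.finite_singleton r).subset fun _ h => h.2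

/-- The rules of the process algebra: `paRules tick f a` are the rules for the operator `f` whose
conclusion has the label `a`, where `tick` is the successful termination action. The arguments
`x, y` of `f` are the variables `0, 1`. -/
noncomputable def paRules (tick : A) : {n : ℕ} → PAOp A n → A → Set (Rule (PASig A) A n)
  | _, .nil, _ => ∅
  | _, .skip, a => rulesIf (a = tick) (rule0 dnil)
  | n, .act b p hp, a => rulesIf (a = b)
      (rule0 (.convex (Fin n) p hp (fun i => .dirac (.var i))))
  | _, .seq, a =>
      rulesIf (a ≠ tick) (rule1 0 a [] (d2 .seq (.var 0) (.dirac (.var 1))))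
      ∪ rulesIf True (rule2 0 tick 1 a (.var 1))
  | _, .alt, a =>
      rulesIf True (rule1 0 a [] (.var 0))
      ∪ rulesIf True (rule1 1 a [] (.var 0))
  | _, .palt p, a =>
      rulesIf True (rule1 0 a [(1, a)] (.var 0))
      ∪ rulesIf True (rule1 1 a [(0, a)] (.var 0))
      ∪ rulesIf True (rule2 0 a 1 a (mix p (.var 0) (.var 1)))
  | _, .sync, a =>
      rulesIf (a ≠ tick) (rule2 0 a 1 a (d2 .sync (.var 0) (.var 1)))
      ∪ rulesIf (a = tick) (rule2 0 tick 1 tick dnil)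
  | _, .async, a =>
      rulesIf (a ≠ tick) (rule1 0 a [] (d2 .async (.var 0) (.dirac (.var 1))))
      ∪ rulesIf (a ≠ tick) (rule1 1 a [] (d2 .async (.dirac (.var 0)) (.var 0)))
      ∪ rulesIf (a = tick) (rule2 0 tick 1 tick dnil)
  | _, .pasync p, a =>
      rulesIf (a ≠ tick) (rule1 0 a [(1, a)] (d2 (.pasync p) (.var 0) (.dirac (.var 1))))
      ∪ rulesIf (a ≠ tick) (rule1 1 a [(0, a)] (d2 (.pasync p) (.dirac (.var 0)) (.var 0)))
      ∪ rulesIf (a ≠ tick) (rule2 0 a 1 a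
          (mix p (d2 (.pasync p) (.var 0) (.dirac (.var 1)))
            (d2 (.pasync p) (.dirac (.var 0)) (.var 1))))
      ∪ rulesIf (a = tick) (rule2 0 tick 1 tick dnil)
  | _, .csp B, a =>
      rulesIf (a ∈ B ∧ a ≠ tick) (rule2 0 a 1 a (d2 (.csp B) (.var 0) (.var 1)))
      ∪ rulesIf (a = tick) (rule2 0 tick 1 tick dnil)
      ∪ rulesIf (a ∉ B ∧ a ≠ tick) (rule1 0 a [] (d2 (.csp B) (.var 0) (.dirac (.var 1))))
      ∪ rulesIf (a ∉ B ∧ a ≠ tick) (rule1 1 a [] (d2 (.csp B) (.dirac (.var 0)) (.var 0)))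
  | _, .iter 0, a => rulesIf (a = tick) (rule0 dnil)
  | _, .iter (n + 1), a =>
      rulesIf (a ≠ tick) (rule1 0 a [] (d2 .seq (.var 0) (.dirac (t1 (.iter n) (.var 0)))))
      ∪ rulesIf (a = tick) (rule1 0 tick [] (.var 0))
      ∪ ⋃ m : Fin (n + 1), rulesIf (a ≠ tick)
          (rule2 0 tick 0 a (d2 .seq (.var 1) (.dirac (t1 (.iter m) (.var 0)))))
  | _, .omega, a =>
      rulesIf (a ≠ tick) (rule1 0 a [] (d2 .seq (.var 0) (.dirac (t1 .omega (.var 0)))))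
  | _, .kleene, a =>
      rulesIf (a ≠ tick)
        (rule1 0 a [] (d2 .seq (.var 0) (.dirac (t2 .kleene (.var 0) (.var 1)))))
      ∪ rulesIf True (rule1 1 a [] (.var 0))
  | _, .pkleene p, a =>
      rulesIf (a ≠ tick) (rule2 0 a 1 a
        (mix p (.var 1) (d2 .seq (.var 0) (.dirac (t2 (.pkleene p) (.var 0) (.var 1))))))
      ∪ rulesIf (a ≠ tick) (rule1 0 a [(1, a)]
          (d2 .seq (.var 0) (.dirac (t2 (.pkleene p) (.var 0) (.var 1)))))
      ∪ rulesIf (a ≠ tick) (rule1 1 a [(0, a)] (.var 0))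
      ∪ rulesIf (a = tick) (rule1 1 tick [] (.var 0))
  | _, .repl 0, a => rulesIf (a = tick) (rule0 dnil)
  | _, .repl (n + 1), a =>
      rulesIf (a ≠ tick) (rule1 0 a [] (d2 .async (.var 0) (.dirac (t1 (.repl n) (.var 0)))))
      ∪ rulesIf (a = tick) (rule1 0 tick [] (.var 0))
  | _, .bang, a =>
      rulesIf (a ≠ tick) (rule1 0 a [] (d2 .async (.var 0) (.dirac (t1 .bang (.var 0)))))
  | _, .pbang p, a =>
      rulesIf (a ≠ tick) (rule1 0 a []
        (mix p (.var 0) (d2 .async (.var 0) (.dirac (t1 (.pbang p) (.var 0))))))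

theorem paRules_finite (tick : A) {n : ℕ} (f : PAOp A n) (a : A) :
    (paRules tick f a).Finite := by
  unfold paRules
  split <;> simp only [Set.finite_union, rulesIf_finite, Set.finite_empty, and_self, true_and]
  exact Set.finite_iUnion fun _ => rulesIf_finite _ _

/-- The specification of the process algebra with all non-recursive and recursive combinators. -/
noncomputable def PA (tick : A) : PTSS (PASig A) A where
  rules := fun f a => paRules tick f a
  finite_rules := fun f a => paRules_finite tick f a

end Rules

/-! ### The example processes -/

/-- The process `a.ε`. -/
noncomputable def actSkip {A : Type v} (a : A) : Proc (PASig A) :=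
  .op (S := PASig A)
    (PAOp.act a (PMF.pure (0 : Fin 1)) (fun i => by simp [Subsingleton.elim i 0]))
    ![.op (S := PASig A) PAOp.skip ![]]

/-- The process `a.([p]ε ⊕ [1 - p]0)`. -/
noncomputable def actSkipOrNil {A : Type v} (a : A) (p : Prob) : Proc (PASig A) :=
  .op (S := PASig A) (PAOp.act a p.weights p.weights_ne_zero)
    ![.op (S := PASig A) PAOp.skip ![], .op (S := PASig A) PAOp.nil ![]]

end ProbProc

namespace ProbProc

universe u v w

/-! ### The Kantorovich lifting -/

section Kantorovich

variable {T : Type u}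

theorem tsum_mul_map_toReal {I : Type} [Fintype I] (p : PMF I) (f : I → T) (g : T → ℝ) :
    ∑' x, g x * ((p.map f) x).toReal = ∑ i, g (f i) * (p i).toReal := by
  classical
  have h : ∀ x, g x * ((p.map f) x).toReal
      = ∑ i, if x = f i then g (f i) * (p i).toReal else 0 := by
    intro x
    rw [PMF.map_apply, tsum_fintype, ENNReal.toReal_sum, Finset.mul_sum]
    · refine Finset.sum_congr rfl fun i _ => ?_
      by_cases hx : x = f i
      · simp [hx]
      · simp [hx]
    · intro i _
      split_ifs
      · exact p.apply_ne_top i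
      · simp
  simp_rw [h]
  rw [Summable.tsum_finsetSum]
  · exact Finset.sum_congr rfl fun i _ => tsum_ite_eq _ _
  · intro i _
    refine summable_of_ne_finset_zero (s := {f i}) fun x hx => ?_
    rw [if_neg (by simpa using hx)]

/-- A Dirac second marginal confines the support of `ω` to pairs `(x, v)`, so the first marginal
determines `ω`. -/
theorem IsMatching.eq_map_of_pure {π : PMF T} {v : T} {ω : PMF (T × T)}
    (h : IsMatching π (PMF.pure v) ω) : ω = π.map fun x => (x, v) := by
  have hs : ∀ x, ω x ≠ 0 → x.2 = v := by
    intro x hx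
    have : x.2 ∈ (ω.map Prod.snd).support := by
      rw [PMF.support_map]
      exact ⟨x, hx, rfl⟩
    rw [h.2] at this
    simpa using this
  rw [← h.1, PMF.map_comp]
  conv_lhs => rw [← PMF.bind_pure ω]
  rw [← PMF.bind_pure_comp]
  ext y
  rw [PMF.bind_apply, PMF.bind_apply]
  refine tsum_congr fun x => ?_
  by_cases hx : ω x = 0
  · simp [hx]
  · have : (x.1, v) = x := by rw [← hs x hx]
    simp [this]

theorem isMatching_map_pure (π : PMF T) (v : T) :
    IsMatching π (PMF.pure v) (π.map fun x => (x, v)) := by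
  constructor
  · rw [PMF.map_comp]
    exact PMF.map_id π
  · rw [PMF.map_comp]
    exact PMF.map_const π v

/-- The only matching of a distribution with a Dirac distribution is the product. -/
theorem kantorovich_map_pure {I : Type} [Fintype I] (d : T → T → ℝ) (p : PMF I) (f : I → T)
    (v : T) : kantorovich d (p.map f) (PMF.pure v) = ∑ i, d (f i) v * (p i).toReal := by
  have : Nonempty {ω : PMF (T × T) // IsMatching (p.map f) (PMF.pure v) ω} :=
    ⟨⟨_, isMatching_map_pure _ v⟩⟩
  rw [kantorovich, ← tsum_mul_map_toReal p (fun i => (f i, v)) fun x => d x.1 x.2]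
  -- All matchings coincide, so the infimum is that of a constant family; nonemptiness matters
  -- because an empty real infimum would be 0.
  refine (iInf_congr fun ω => ?_).trans ciInf_const
  rw [ω.2.eq_map_of_pure, PMF.map_comp]
  rfl

theorem IsMatching.swap {π π' : PMF T} {ω : PMF (T × T)} (h : IsMatching π π' ω) :
    IsMatching π' π (ω.map Prod.swap) := by
  constructor
  · rw [PMF.map_comp]
    exact h.2
  · rw [PMF.map_comp]
    exact h.1

theorem map_swap_apply (ω : PMF (T × T)) (x : T × T) : ω.map Prod.swap x = ω x.swap := by
  classical
  rw [PMF.map_apply, tsum_eq_single x.swap]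
  · simp
  · intro y hy
    rw [if_neg]
    rintro rfl
    exact hy (by simp)

/-- Swapping coordinates is a cost-preserving bijection between the couplings of the two orders. -/
theorem kantorovich_comm {d : T → T → ℝ} (hd : ∀ x y, d x y = d y x) (π π' : PMF T) :
    kantorovich d π π' = kantorovich d π' π := by
  let e : {ω : PMF (T × T) // IsMatching π π' ω} ≃ {ω : PMF (T × T) // IsMatching π' π ω} :=
    { toFun := fun ω => ⟨_, ω.2.swap⟩
      invFun := fun ω => ⟨_, ω.2.swap⟩
      left_inv := fun ω => Subtype.ext (PMF.ext fun x => by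
        simp only [map_swap_apply, Prod.swap_swap])
      right_inv := fun ω => Subtype.ext (PMF.ext fun x => by
        simp only [map_swap_apply, Prod.swap_swap]) }
  refine e.iInf_congr fun ω => ?_
  rw [← (Equiv.prodComm T T).tsum_eq]
  refine tsum_congr fun x => ?_
  simp only [e, Equiv.coe_fn_mk, map_swap_apply, Equiv.prodComm_apply, Prod.swap_swap]
  rw [hd]
  rfl

/-- The diagonal coupling has cost 0. -/
theorem kantorovich_self_le {d : T → T → ℝ} (hd : IsBoundedPseudometric d) (π : PMF T) :
    kantorovich d π π ≤ 0 := by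
  have hb : BddBelow (Set.range fun ω : {ω : PMF (T × T) // IsMatching π π ω} =>
      ∑' x : T × T, d x.1 x.2 * (ω.1 x).toReal) := by
    refine ⟨0, ?_⟩
    rintro _ ⟨ω, rfl⟩
    exact tsum_nonneg fun x => mul_nonneg (hd.nonneg _ _) ENNReal.toReal_nonneg
  have hm : IsMatching π π (π.map fun x => (x, x)) := by
    constructor <;> rw [PMF.map_comp] <;> exact PMF.map_id π
  refine (ciInf_le hb ⟨_, hm⟩).trans (le_of_eq ?_)
  refine (tsum_congr fun x => ?_).trans tsum_zero
  by_cases hx : (π.map fun x => (x, x)) x = 0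
  · simp [hx]
  · have : x ∈ (π.map fun x => (x, x)).support := hx
    rw [PMF.support_map] at this
    obtain ⟨y, -, rfl⟩ := this
    simp [hd.self]

/-- The distribution with weight `p` on `x` and `1 - p` on `y`. -/
noncomputable def twoPoint (p : Prob) (x y : T) : PMF T := p.weights.map ![x, y]

theorem twoPoint_map {T' : Type w} (p : Prob) (x y : T) (f : T → T') :
    (twoPoint p x y).map f = twoPoint p (f x) (f y) := by
  rw [twoPoint, PMF.map_comp, twoPoint]
  congr 1
  funext i
  fin_cases i <;> rfl

theorem kantorovich_twoPoint_pure (d : T → T → ℝ) (p : Prob) (x y v : T) :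
    kantorovich d (twoPoint p x y) (PMF.pure v) = p.1 * d x v + (1 - p.1) * d y v := by
  rw [twoPoint, kantorovich_map_pure, Fin.sum_univ_two]
  have h0 := p.2.1.le
  have h1 : 0 ≤ 1 - p.1 := by linarith [p.2.2]
  simp [Prob.weights, ENNReal.toReal_ofReal, h0, h1, mul_comm]

end Kantorovich

/-! ### Bisimulation metrics -/

section Metric

variable {S : Signature.{u}} {A : Type v} {M : PTS S A}

/-- Makes the infimum in `bisimDist` range over a nonempty family, and bounds it by 1 in general and
by 0 on the diagonal. -/
theorem isBisimMetric_discrete [DecidableEq (Proc S)] (M : PTS S A) :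
    IsBisimMetric M 1 fun s t => if s = t then 0 else 1 := by
  have hd : IsBoundedPseudometric fun s t : Proc S => if s = t then (0 : ℝ) else 1 := by
    constructor
    · intro s t; split_ifs <;> norm_num
    · intro s t; split_ifs <;> norm_num
    · intro t; simp
    · intro s t; simp only [eq_comm]
    · intro s t u
      split_ifs <;> first | linarith | grind
  refine ⟨hd, fun t t' h a π hπ => ⟨π, ?_, ?_⟩⟩
  · rcases eq_or_ne t t' with rfl | hne
    · exact hπ
    · simp [hne] at h
  · rw [one_mul]
    exact (kantorovich_self_le hd π).trans (hd.nonneg t t')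

instance nonempty_isBisimMetric (M : PTS S A) :
    Nonempty {d : Proc S → Proc S → ℝ // IsBisimMetric M 1 d} := by
  classical
  exact ⟨⟨_, isBisimMetric_discrete M⟩⟩

theorem bisimDist_le {d : Proc S → Proc S → ℝ} (hd : IsBisimMetric M 1 d) (s t : Proc S) :
    bisimDist M 1 s t ≤ d s t := by
  refine ciInf_le (f := fun d : {d : Proc S → Proc S → ℝ // IsBisimMetric M 1 d} => d.1 s t)
    ⟨0, ?_⟩ ⟨d, hd⟩
  rintro _ ⟨d, rfl⟩
  exact d.2.nonneg s t

theorem le_bisimDist {c : ℝ} {s t : Proc S} (h : ∀ d, IsBisimMetric M 1 d → c ≤ d s t) :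
    c ≤ bisimDist M 1 s t :=
  le_ciInf fun d => h d.1 d.2

theorem bisimDist_le_one (s t : Proc S) : bisimDist M 1 s t ≤ 1 := by
  classical
  exact (bisimDist_le (isBisimMetric_discrete M) s t).trans
    ((isBisimMetric_discrete M).le_one s t)

theorem bisimDist_self_le (t : Proc S) : bisimDist M 1 t t ≤ 0 := by
  classical
  exact (bisimDist_le (isBisimMetric_discrete M) t t).trans
    ((isBisimMetric_discrete M).self t).le

/-- A distance below 1 would force a matching transition. This is how a visible deviation acquires
distance 1. -/
theorem IsBisimMetric.eq_one {d : Proc S → Proc S → ℝ} (hd : IsBisimMetric M 1 d)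
    {s t : Proc S} {a : A} {π : PMF (Proc S)} (hs : M.trans s a π)
    (ht : ∀ π', ¬ M.trans t a π') : d s t = 1 := by
  by_contra h
  obtain ⟨π', h', -⟩ := hd.transfer s t (lt_of_le_of_ne (hd.le_one s t) h) a π hs
  exact ht π' h'

/-- A process with the single transition `a, [p]z ⊕ [1 - p]w` has distance at most `1 - p` from
one with the single transition `a, δ(z)`. -/
theorem bisimDist_le_of_trans {s t z w : Proc S} {a : A} (p : Prob)
    (hs : ∀ c π, M.trans s c π ↔ c = a ∧ π = twoPoint p z w)
    (ht : ∀ c π, M.trans t c π ↔ c = a ∧ π = PMF.pure z) :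
    bisimDist M 1 s t ≤ 1 - p.1 := by
  classical
  have hp0 := p.2.1
  have hp1 := p.2.2
  -- The discrete metric with the single pair `s, t` moved to distance `1 - p`. A detour through a
  -- third process costs at least 1, so the triangle inequality survives; the first branch covers `s
  -- = t`.
  let d : Proc S → Proc S → ℝ := fun x y =>
    if x = y then 0 else if (x = s ∧ y = t) ∨ (x = t ∧ y = s) then 1 - p.1 else 1
  have hd : IsBoundedPseudometric d := by
    constructor
    · intro x y; simp only [d]; split_ifs <;> linarith
    · intro x y; simp only [d]; split_ifs <;> linarith
    · intro x; simp [d]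
    · intro x y
      simp only [d]
      split_ifs <;> first | rfl | grind
    · intro x y z
      simp only [d]
      split_ifs <;> first | linarith | grind
  have hst : kantorovich d (twoPoint p z w) (PMF.pure z) ≤ 1 - p.1 := by
    -- Mass `p` is already at `z`, and the remaining `1 - p` travels at most distance 1.
    rw [kantorovich_twoPoint_pure, hd.self]
    nlinarith [hd.le_one w z]
  have hB : IsBisimMetric M 1 d := by
    refine ⟨hd, fun x y h c π hπ => ?_⟩
    by_cases hxy : x = y
    · subst hxy
      refine ⟨π, hπ, ?_⟩
      rw [one_mul, hd.self]
      exact kantorovich_self_le hd π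
    · by_cases h' : (x = s ∧ y = t) ∨ (x = t ∧ y = s)
      · have hv : d x y = 1 - p.1 := by simp only [d, if_neg hxy, if_pos h']
        rw [hv]
        rcases h' with ⟨rfl, rfl⟩ | ⟨rfl, rfl⟩
        · obtain ⟨rfl, rfl⟩ := (hs c π).1 hπ
          exact ⟨_, (ht c _).2 ⟨rfl, rfl⟩, by rwa [one_mul]⟩
        · obtain ⟨rfl, rfl⟩ := (ht c π).1 hπ
          exact ⟨_, (hs c _).2 ⟨rfl, rfl⟩, by rwa [one_mul, kantorovich_comm hd.symm]⟩
      · simp [d, if_neg hxy, if_neg h'] at h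
  refine (bisimDist_le hB s t).trans ?_
  simp only [d]
  split_ifs with h1 h2
  · linarith
  · exact le_rfl
  · exact absurd (by simp) h2

/-- Every answer of `t` leads to the same Dirac distribution, so the unique coupling must send the
mass `1 - p` from `y` to `v` at full cost. If `d s t = 1`, the bound is trivial. -/
theorem IsBisimMetric.twoPoint_le {d : Proc S → Proc S → ℝ} (hd : IsBisimMetric M 1 d)
    {s t x y v : Proc S} {a : A} {p : Prob} (hs : M.trans s a (twoPoint p x y))
    (ht : ∀ π, M.trans t a π → π = PMF.pure v) (hy : d y v = 1) :
    p.1 * d x v + (1 - p.1) ≤ d s t := by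
  rcases (hd.le_one s t).lt_or_eq with h | h
  · obtain ⟨π', h', hle⟩ := hd.transfer s t h a _ hs
    rw [ht π' h', one_mul, kantorovich_twoPoint_pure, hy] at hle
    linarith
  · rw [h]
    nlinarith [hd.le_one x v, p.2.1]

/-- If along `u 0, u 1, …` one leaves with probability `1 - p` in each step to a process at
distance one from the counterpart `v 0, v 1, …`, then `u 0` and `v 0` have distance one. -/
theorem IsBisimMetric.eq_one_of_chain {d : Proc S → Proc S → ℝ} (hd : IsBisimMetric M 1 d)
    {u v w : ℕ → Proc S} {a : A} {p : Prob}
    (hu : ∀ n, M.trans (u n) a (twoPoint p (u (n + 1)) (w n)))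
    (hv : ∀ n π, M.trans (v n) a π → π = PMF.pure (v (n + 1)))
    (hw : ∀ n, d (w n) (v (n + 1)) = 1) : d (u 0) (v 0) = 1 := by
  -- Passing to `1 - d` turns the affine recursion into a geometric one.
  have hstep : ∀ n, 1 - d (u n) (v n) ≤ p.1 * (1 - d (u (n + 1)) (v (n + 1))) := fun n => by
    linarith [hd.twoPoint_le (hu n) (hv n) (hw n)]
  have hpow : ∀ n, 1 - d (u 0) (v 0) ≤ p.1 ^ n * (1 - d (u n) (v n)) := by
    intro n
    induction n with
    | zero => simp
    | succ n ih =>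
      rw [pow_succ, mul_assoc]
      exact ih.trans (mul_le_mul_of_nonneg_left (hstep n) (pow_nonneg p.2.1.le n))
  have hlim := tendsto_pow_atTop_nhds_zero_of_lt_one p.2.1.le p.2.2
  have : 1 - d (u 0) (v 0) ≤ 0 := ge_of_tendsto' hlim fun n =>
    (hpow n).trans (mul_le_of_le_one_right (pow_nonneg p.2.1.le n)
      (by linarith [hd.nonneg (u n) (v n)]))
  linarith [hd.le_one (u 0) (v 0)]

end Metric

/-! ### Transitions in disjoint extensions of the process algebra -/

/-- Rule targets such as `μ;δ(y)` have a Dirac factor, so their product distribution is just an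
image of the other factor. -/
theorem map_prodPMF_pure_right {α : Type u} {β : Type w} (f : (Fin 2 → α) → β)
    (π : Fin 2 → PMF α) (y : α) (h : π 1 = PMF.pure y) :
    (prodPMF 2 π).map f = (π 0).map fun x => f ![x, y] := by
  simp only [prodPMF, Fin.succ_zero_eq_one, h]
  rw [PMF.map_bind, ← PMF.bind_pure_comp]
  congr 1
  funext x
  simp only [PMF.pure_bind, PMF.pure_map, Function.comp_apply]
  congr 2

theorem map_prodPMF_pure_left {α : Type u} {β : Type w} (f : (Fin 2 → α) → β)
    (π : Fin 2 → PMF α) (x : α) (h : π 0 = PMF.pure x) :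
    (prodPMF 2 π).map f = (π 1).map fun y => f ![x, y] := by
  simp only [prodPMF, Fin.succ_zero_eq_one, h]
  rw [PMF.pure_bind, PMF.map_comp, PMF.map_bind, ← PMF.bind_pure_comp]
  congr 1
  funext y
  simp only [PMF.pure_map, Function.comp_apply]
  congr 2

section Transitions

variable {A : Type v} {S : Signature.{w}} {tick : A} {P : PTSS S A}

/-- The rule `r`, read in the extension, derives the distribution `π` for the arguments `ts`. -/
def Rule.Derives (E : DisjointExtension (PA tick) P) (M : PTS S A) {n : ℕ}
    (r : Rule (PASig A) A n) (ts : Fin n → Proc S) (π : PMF (Proc S)) : Prop :=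
  ∃ ρ : Fin r.numPos → PMF (Proc S), (r.mapOp fun {_} g => E.ι g).Premises M ts ρ ∧
    π = (r.target.mapOp fun {_} g => E.ι g).eval ts ρ

variable (E : DisjointExtension (PA tick) P) {M : PTS S A}

/-- Disjointness of the extension enters here, through `rules_eq`: new operators may occur in the
arguments, but no new rule applies to `f`. -/
theorem trans_op_iff (hM : P.IsSupportedModel M) {n : ℕ} (f : PAOp A n) (ts : Fin n → Proc S)
    (a : A) (π : PMF (Proc S)) :
    M.trans (.op (E.ι f) ts) a π ↔ ∃ r ∈ paRules tick f a, r.Derives E M ts π := by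
  have hr : P.rules (E.ι f) a = Rule.mapOp (fun {_} g => E.ι g) '' paRules tick f a :=
    E.rules_eq f a
  rw [hM]
  constructor
  · rintro ⟨n, g, r, σ, ρ, hmem, hprem, heq, rfl⟩
    cases heq
    rw [hr] at hmem
    obtain ⟨r, hmem, rfl⟩ := hmem
    exact ⟨r, hmem, ρ, hprem, rfl⟩
  · rintro ⟨r, hmem, ρ, hprem, rfl⟩
    exact ⟨n, _, r.mapOp fun {_} g => E.ι g, ts, ρ, hr ▸ ⟨r, hmem, rfl⟩, hprem, rfl, rfl⟩

theorem exists_mem_union {n : ℕ} {R R' : Set (Rule (PASig A) A n)}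
    {Q : Rule (PASig A) A n → Prop} :
    (∃ r ∈ R ∪ R', Q r) ↔ (∃ r ∈ R, Q r) ∨ ∃ r ∈ R', Q r := by
  simp only [Set.mem_union, or_and_right, exists_or]

theorem exists_mem_rulesIf {n : ℕ} {c : Prop} {r : Rule (PASig A) A n}
    {Q : Rule (PASig A) A n → Prop} : (∃ r' ∈ rulesIf c r, Q r') ↔ c ∧ Q r := by
  constructor
  · rintro ⟨r', ⟨hc, rfl⟩, hQ⟩
    exact ⟨hc, hQ⟩
  · rintro ⟨hc, hQ⟩
    exact ⟨r, ⟨hc, rfl⟩, hQ⟩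

theorem derives_rule0 {n : ℕ} (θ : DTerm (PASig A) (Fin n) (Fin 0)) (ts : Fin n → Proc S)
    (π : PMF (Proc S)) : (rule0 θ).Derives E M ts π ↔
      π = (θ.mapOp fun {_} g => E.ι g).eval ts ![] := by
  constructor
  · rintro ⟨ρ, -, rfl⟩
    exact congrArg (DTerm.eval ts · _) (Subsingleton.elim (α := Fin 0 → PMF (Proc S)) _ _)
  · rintro rfl
    exact ⟨![], ⟨fun k => k.elim0, fun q hq => absurd hq List.not_mem_nil⟩, rfl⟩

theorem derives_rule1 {n : ℕ} (i : Fin n) (b : A) (neg : List (Fin n × A))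
    (θ : DTerm (PASig A) (Fin n) (Fin 1)) (ts : Fin n → Proc S) (π : PMF (Proc S)) :
    (rule1 i b neg θ).Derives E M ts π ↔ ∃ μ, M.trans (ts i) b μ ∧
      (∀ q ∈ neg, ∀ π, ¬ M.trans (ts q.1) q.2 π) ∧
      π = (θ.mapOp fun {_} g => E.ι g).eval ts ![μ] := by
  constructor
  · rintro ⟨ρ, ⟨h1, h2⟩, rfl⟩
    refine ⟨ρ (0 : Fin 1), h1 (0 : Fin 1), h2, congrArg (DTerm.eval ts · _) ?_⟩
    funext k
    fin_cases k
    rfl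
  · rintro ⟨μ, h1, h2, rfl⟩
    refine ⟨![μ], ⟨fun k => ?_, h2⟩, rfl⟩
    obtain rfl : k = (0 : Fin 1) := Subsingleton.elim (α := Fin 1) _ _
    exact h1

theorem derives_rule2 {n : ℕ} (i : Fin n) (b : A) (j : Fin n) (c : A)
    (θ : DTerm (PASig A) (Fin n) (Fin 2)) (ts : Fin n → Proc S) (π : PMF (Proc S)) :
    (rule2 i b j c θ).Derives E M ts π ↔ ∃ μ ν, M.trans (ts i) b μ ∧ M.trans (ts j) c ν ∧
      π = (θ.mapOp fun {_} g => E.ι g).eval ts ![μ, ν] := by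
  constructor
  · rintro ⟨ρ, ⟨h1, -⟩, rfl⟩
    refine ⟨ρ (0 : Fin 2), ρ (1 : Fin 2), h1 (0 : Fin 2), h1 (1 : Fin 2),
      congrArg (DTerm.eval ts · _) ?_⟩
    funext k
    fin_cases k <;> rfl
  · rintro ⟨μ, ν, h1, h2, rfl⟩
    refine ⟨![μ, ν], ⟨fun k => ?_, fun q hq => absurd hq List.not_mem_nil⟩, rfl⟩
    change Fin 2 at k
    fin_cases k
    · exact h1
    · exact h2

theorem eval_d2_dirac_right {n m : ℕ} (f : PAOp A 2) (θ : DTerm (PASig A) (Fin n) (Fin m))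
    (t : Term (PASig A) (Fin n)) (ts : Fin n → Proc S) (ρ : Fin m → PMF (Proc S)) :
    ((d2 f θ (.dirac t)).mapOp fun {_} g => E.ι g).eval ts ρ =
      ((θ.mapOp fun {_} g => E.ι g).eval ts ρ).map fun x =>
        .op (E.ι f) ![x, (t.mapOp fun {_} g => E.ι g).subst ts] :=
  map_prodPMF_pure_right _ _ _ rfl

theorem eval_d2_dirac_left {n m : ℕ} (f : PAOp A 2) (θ : DTerm (PASig A) (Fin n) (Fin m))
    (t : Term (PASig A) (Fin n)) (ts : Fin n → Proc S) (ρ : Fin m → PMF (Proc S)) :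
    ((d2 f (.dirac t) θ).mapOp fun {_} g => E.ι g).eval ts ρ =
      ((θ.mapOp fun {_} g => E.ι g).eval ts ρ).map fun y =>
        .op (E.ι f) ![(t.mapOp fun {_} g => E.ι g).subst ts, y] :=
  map_prodPMF_pure_left _ _ _ rfl

/-- The stop process of the extension. -/
def nilProc : Proc S := .op (E.ι .nil) ![]

/-- The skip process of the extension. -/
def skipProc : Proc S := .op (E.ι .skip) ![]

/-- The process `a.x` of the extension. -/
noncomputable def actOne (a : A) (x : Proc S) : Proc S :=
  .op (E.ι (.act a (PMF.pure (0 : Fin 1)) fun i => by simp [Subsingleton.elim i 0])) ![x]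

/-- The process `a.([p]x ⊕ [1 - p]y)` of the extension. -/
noncomputable def actTwo (a : A) (p : Prob) (x y : Proc S) : Proc S :=
  .op (E.ι (.act a p.weights p.weights_ne_zero)) ![x, y]

theorem actSkip_mapOp (a : A) :
    (actSkip a).mapOp (fun {_} f => E.ι f) = actOne E a (skipProc E) := by
  simp only [actSkip, Term.mapOp, actOne, skipProc]
  congr 1
  funext i
  fin_cases i
  exact congrArg (Term.op (E.ι PAOp.skip)) (Subsingleton.elim _ _)

theorem actSkipOrNil_mapOp (a : A) (p : Prob) :
    (actSkipOrNil a p).mapOp (fun {_} f => E.ι f) = actTwo E a p (skipProc E) (nilProc E) := by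
  simp only [actSkipOrNil, Term.mapOp, actTwo, skipProc, nilProc]
  congr 1
  funext i
  fin_cases i
  · exact congrArg (Term.op (E.ι PAOp.skip)) (Subsingleton.elim _ _)
  · exact congrArg (Term.op (E.ι PAOp.nil)) (Subsingleton.elim _ _)

theorem not_trans_nilProc (hM : P.IsSupportedModel M) (a : A) (π : PMF (Proc S)) :
    ¬ M.trans (nilProc E) a π := by
  rw [nilProc, trans_op_iff E hM]
  rintro ⟨r, hr, -⟩
  exact hr

theorem trans_skipProc_iff (hM : P.IsSupportedModel M) (a : A) (π : PMF (Proc S)) :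
    M.trans (skipProc E) a π ↔ a = tick ∧ π = PMF.pure (nilProc E) := by
  have h : ((dnil : DTerm (PASig A) (Fin 0) (Fin 0)).mapOp fun {_} g => E.ι g).eval ![] ![] =
      PMF.pure (nilProc E) :=
    congrArg (fun ts => PMF.pure (Term.op (E.ι PAOp.nil) ts)) (Subsingleton.elim _ _)
  rw [skipProc, trans_op_iff E hM, paRules, exists_mem_rulesIf, derives_rule0, h]

theorem trans_act_iff (hM : P.IsSupportedModel M) {n : ℕ} (b : A) (p : PMF (Fin n))
    (hp : ∀ i, p i ≠ 0) (ts : Fin n → Proc S) (a : A) (π : PMF (Proc S)) :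
    M.trans (.op (E.ι (.act b p hp)) ts) a π ↔ a = b ∧ π = p.map ts := by
  rw [trans_op_iff E hM, paRules, exists_mem_rulesIf, derives_rule0]
  rfl

theorem trans_actOne_iff (hM : P.IsSupportedModel M) (b : A) (x : Proc S) (a : A)
    (π : PMF (Proc S)) : M.trans (actOne E b x) a π ↔ a = b ∧ π = PMF.pure x := by
  rw [actOne, trans_act_iff E hM, PMF.pure_map]
  rfl

theorem trans_actTwo_iff (hM : P.IsSupportedModel M) (b : A) (p : Prob) (x y : Proc S) (a : A)
    (π : PMF (Proc S)) : M.trans (actTwo E b p x y) a π ↔ a = b ∧ π = twoPoint p x y :=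
  trans_act_iff E hM _ _ _ _ _ _

theorem trans_seq_iff (hM : P.IsSupportedModel M) (x y : Proc S) (a : A) (π : PMF (Proc S)) :
    M.trans (.op (E.ι .seq) ![x, y]) a π ↔
      (a ≠ tick ∧ ∃ μ, M.trans x a μ ∧ π = μ.map fun z => .op (E.ι .seq) ![z, y]) ∨
        ((∃ μ, M.trans x tick μ) ∧ M.trans y a π) := by
  rw [trans_op_iff E hM, paRules, exists_mem_union, exists_mem_rulesIf, exists_mem_rulesIf,
    derives_rule1, derives_rule2]
  simp only [eval_d2_dirac_right]
  simp [DTerm.mapOp, DTerm.eval, Term.mapOp, Term.subst]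

theorem trans_async_iff (hM : P.IsSupportedModel M) (x y : Proc S) {a : A} (ha : a ≠ tick)
    (π : PMF (Proc S)) : M.trans (.op (E.ι .async) ![x, y]) a π ↔
      (∃ μ, M.trans x a μ ∧ π = μ.map fun z => .op (E.ι .async) ![z, y]) ∨
        ∃ ν, M.trans y a ν ∧ π = ν.map fun z => .op (E.ι .async) ![x, z] := by
  rw [trans_op_iff E hM, paRules, exists_mem_union, exists_mem_union, exists_mem_rulesIf,
    exists_mem_rulesIf, exists_mem_rulesIf, derives_rule1, derives_rule1]
  simp only [eval_d2_dirac_right, eval_d2_dirac_left]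
  simp [DTerm.mapOp, DTerm.eval, Term.mapOp, Term.subst, ha]

theorem trans_bang_iff (hM : P.IsSupportedModel M) (x : Proc S) {a : A} (ha : a ≠ tick)
    (π : PMF (Proc S)) : M.trans (.op (E.ι .bang) ![x]) a π ↔
      ∃ μ, M.trans x a μ ∧
        π = μ.map fun z => .op (E.ι .async) ![z, .op (E.ι .bang) ![x]] := by
  have h : ((t1 .bang (.var 0) : Term (PASig A) (Fin 1)).mapOp fun {_} g => E.ι g).subst ![x] =
      .op (E.ι .bang) ![x] :=
    congrArg (Term.op (E.ι PAOp.bang)) (funext fun i => by fin_cases i; rfl)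
  rw [trans_op_iff E hM, paRules, exists_mem_rulesIf, derives_rule1]
  simp only [eval_d2_dirac_right, h]
  simp [DTerm.mapOp, DTerm.eval, ha]

/-! ### Iteration operators as loops -/

/-- The `a`-transitions of `u` are those of `x`, followed by a restart of `u`. -/
def IsLoop (M : PTS S A) (a : A) (x u : Proc S) : Prop :=
  ∀ π, M.trans u a π ↔ ∃ μ, M.trans x a μ ∧ π = μ.map fun z => .op (E.ι .seq) ![z, u]

theorem isLoop_omega (hM : P.IsSupportedModel M) (x : Proc S) {a : A} (ha : a ≠ tick) :
    IsLoop E M a x (.op (E.ι .omega) ![x]) := by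
  intro π
  have h : ((t1 .omega (.var 0) : Term (PASig A) (Fin 1)).mapOp fun {_} g => E.ι g).subst ![x] =
      .op (E.ι .omega) ![x] :=
    congrArg (Term.op (E.ι PAOp.omega)) (funext fun i => by fin_cases i; rfl)
  rw [trans_op_iff E hM, paRules, exists_mem_rulesIf, derives_rule1]
  simp only [eval_d2_dirac_right, h]
  simp [DTerm.mapOp, DTerm.eval, ha]

theorem subst_t2 (f : PAOp A 2) (x y : Proc S) :
    ((t2 f (.var 0) (.var 1) : Term (PASig A) (Fin 2)).mapOp fun {_} g => E.ι g).subst ![x, y] =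
      .op (E.ι f) ![x, y] :=
  congrArg (Term.op (E.ι f)) (funext fun i => by fin_cases i <;> rfl)

theorem isLoop_kleene (hM : P.IsSupportedModel M) (x : Proc S) {a : A} (ha : a ≠ tick) :
    IsLoop E M a x (.op (E.ι .kleene) ![x, nilProc E]) := by
  intro π
  rw [trans_op_iff E hM, paRules, exists_mem_union, exists_mem_rulesIf, exists_mem_rulesIf,
    derives_rule1, derives_rule1]
  simp only [eval_d2_dirac_right, subst_t2]
  simp [DTerm.mapOp, DTerm.eval, ha, not_trans_nilProc E hM]

/-- As `0` has no transitions, the probabilistic rule never fires and the negative premise on the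
second argument always holds. -/
theorem isLoop_pkleene (hM : P.IsSupportedModel M) (p : Prob) (x : Proc S) {a : A}
    (ha : a ≠ tick) : IsLoop E M a x (.op (E.ι (.pkleene p)) ![x, nilProc E]) := by
  intro π
  rw [trans_op_iff E hM, paRules]
  simp only [exists_mem_union, exists_mem_rulesIf, derives_rule1, derives_rule2,
    eval_d2_dirac_right, subst_t2]
  simp [DTerm.mapOp, DTerm.eval, ha, not_trans_nilProc E hM]

theorem IsBisimMetric.skipProc_nilProc (hM : P.IsSupportedModel M)
    {d : Proc S → Proc S → ℝ} (hd : IsBisimMetric M 1 d) : d (skipProc E) (nilProc E) = 1 :=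
  hd.eq_one ((trans_skipProc_iff E hM _ _).2 ⟨rfl, rfl⟩) (not_trans_nilProc E hM _)

theorem bisimDist_act_le (hM : P.IsSupportedModel M) (a : A) (p : Prob) (x y : Proc S) :
    bisimDist M 1 (actTwo E a p x y) (actOne E a x) ≤ 1 - p.1 :=
  bisimDist_le_of_trans p (trans_actTwo_iff E hM a p x y) (trans_actOne_iff E hM a x)

theorem bisimDist_act_skip_nil (hM : P.IsSupportedModel M) (a : A) (p : Prob) :
    bisimDist M 1 (actTwo E a p (skipProc E) (nilProc E)) (actOne E a (skipProc E))
      = 1 - p.1 := by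
  refine le_antisymm (bisimDist_act_le E hM a p _ _) (le_bisimDist fun d hd => ?_)
  -- The mass `1 - p` on `0` is at distance 1 from `ε`, which can terminate.
  have h := hd.twoPoint_le ((trans_actTwo_iff E hM a p (skipProc E) (nilProc E) a _).2 ⟨rfl, rfl⟩)
    (fun π h => ((trans_actOne_iff E hM a (skipProc E) a π).1 h).2)
    ((hd.symm _ _).trans (hd.skipProc_nilProc E hM))
  rwa [hd.self, mul_zero, zero_add] at h

theorem bisimDist_loop (hM : P.IsSupportedModel M) {a : A} (ha : a ≠ tick) (p : Prob)
    {u v : Proc S} (hu : IsLoop E M a (actTwo E a p (skipProc E) (nilProc E)) u)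
    (hv : IsLoop E M a (actOne E a (skipProc E)) v) : bisimDist M 1 u v = 1 := by
  refine le_antisymm (bisimDist_le_one _ _) (le_bisimDist fun d hd => ?_)
  have hu' : ∀ π, M.trans u a π ↔ π = twoPoint p (.op (E.ι .seq) ![skipProc E, u])
      (.op (E.ι .seq) ![nilProc E, u]) := fun π => by
    rw [hu]
    simp [trans_actTwo_iff E hM, twoPoint_map]
  have hv' : ∀ π, M.trans v a π ↔ π = PMF.pure (.op (E.ι .seq) ![skipProc E, v]) := fun π => by
    rw [hv]
    simp [trans_actOne_iff E hM, PMF.pure_map]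
  have hskip : ∀ (x : Proc S) (π : PMF (Proc S)),
      M.trans (.op (E.ι .seq) ![skipProc E, x]) a π ↔ M.trans x a π := fun x π => by
    rw [trans_seq_iff E hM]
    simp [trans_skipProc_iff E hM, ha]
  have hnil : ∀ (x : Proc S) (π : PMF (Proc S)),
      ¬ M.trans (.op (E.ι .seq) ![nilProc E, x]) a π := fun x π => by
    rw [trans_seq_iff E hM]
    simp [not_trans_nilProc E hM]
  -- From index 1 on the chains are constant, `ε;u` and `ε;v`; index 0 is separate because `u` and
  -- `ε;u` have the same `a`-transitions but are different terms.
  refine (hd.eq_one_of_chain (a := a) (p := p)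
    (u := fun n => n.casesOn u fun _ => .op (E.ι .seq) ![skipProc E, u])
    (v := fun n => n.casesOn v fun _ => .op (E.ι .seq) ![skipProc E, v])
    (w := fun _ => .op (E.ι .seq) ![nilProc E, u]) ?_ ?_ ?_).ge
  · rintro (_ | n)
    · exact (hu' _).2 rfl
    · exact (hskip _ _).2 ((hu' _).2 rfl)
  · rintro (_ | n) π h
    · exact (hv' _).1 h
    · exact (hv' _).1 ((hskip _ _).1 h)
  · intro n
    rw [hd.symm]
    exact hd.eq_one ((hskip _ _).2 ((hv' _).2 rfl)) (hnil u)

/-! ### Bang and its accumulated stopped components -/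

/-- `x` in parallel with `n` copies of the stop process. -/
def padNil (x : Proc S) : ℕ → Proc S
  | 0 => x
  | n + 1 => .op (E.ι .async) ![nilProc E, padNil x n]

/-- A step of a padded bang leaves its new `0` innermost; regrouping turns it into one more layer of
padding. -/
theorem padNil_async (x : Proc S) (n : ℕ) :
    padNil E (.op (E.ι .async) ![nilProc E, x]) n = padNil E x (n + 1) := by
  induction n with
  | zero => rfl
  | succ n ih => rw [padNil, ih]; rfl

theorem trans_padNil_iff (hM : P.IsSupportedModel M) (x : Proc S) {a : A} (ha : a ≠ tick)
    (n : ℕ) (π : PMF (Proc S)) :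
    M.trans (padNil E x n) a π ↔ ∃ μ, M.trans x a μ ∧ π = μ.map fun z => padNil E z n := by
  induction n generalizing π with
  | zero =>
    simp only [padNil]
    constructor
    · exact fun h => ⟨π, h, (PMF.map_id π).symm⟩
    · rintro ⟨μ, h, rfl⟩
      exact (PMF.map_id μ).symm ▸ h
  | succ n ih =>
    rw [padNil, trans_async_iff E hM _ _ ha]
    simp only [not_trans_nilProc E hM, false_and, exists_false, false_or, ih]
    constructor
    · rintro ⟨_, ⟨μ, h, rfl⟩, rfl⟩
      exact ⟨μ, h, PMF.map_comp _ _ _⟩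
    · rintro ⟨μ, h, rfl⟩
      exact ⟨_, ⟨μ, h, rfl⟩, by rw [PMF.map_comp]; rfl⟩

/-- Bang never performs `tick`, so `ε` and `0` cannot be told apart by termination beside it. The
deviation is marked by `b` instead, an action that the padded bang of `a.0` never offers. -/
theorem bisimDist_bang (hM : P.IsSupportedModel M) {a b : A} (ha : a ≠ tick) (hb : b ≠ tick)
    (hba : b ≠ a) (p : Prob) :
    bisimDist M 1 (.op (E.ι .bang) ![actTwo E a p (nilProc E) (actOne E b (nilProc E))])
      (.op (E.ι .bang) ![actOne E a (nilProc E)]) = 1 := by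
  refine le_antisymm (bisimDist_le_one _ _) (le_bisimDist fun d hd => ?_)
  set s := actTwo E a p (nilProc E) (actOne E b (nilProc E))
  set t := actOne E a (nilProc E)
  refine (hd.eq_one_of_chain (a := a) (p := p) (u := padNil E (.op (E.ι .bang) ![s]))
    (v := padNil E (.op (E.ι .bang) ![t]))
    (w := padNil E (.op (E.ι .async) ![actOne E b (nilProc E), .op (E.ι .bang) ![s]]))
    ?_ ?_ ?_).ge
  · intro n
    refine (trans_padNil_iff E hM _ ha n _).2 ⟨_, (trans_bang_iff E hM _ ha _).2
      ⟨_, (trans_actTwo_iff E hM _ _ _ _ _ _).2 ⟨rfl, rfl⟩, rfl⟩, ?_⟩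
    -- Only the branch with `0` becomes padding; the branch with `b.0` is the exit `w n`.
    rw [twoPoint_map, twoPoint_map, padNil_async]
  · intro n π h
    obtain ⟨_, h₁, rfl⟩ := (trans_padNil_iff E hM _ ha n π).1 h
    obtain ⟨_, h₂, rfl⟩ := (trans_bang_iff E hM _ ha _).1 h₁
    obtain ⟨-, rfl⟩ := (trans_actOne_iff E hM _ _ _ _).1 h₂
    rw [PMF.pure_map, PMF.pure_map, padNil_async]
  · intro n
    refine hd.eq_one ((trans_padNil_iff E hM _ hb n _).2 ⟨_, (trans_async_iff E hM _ _ hb _).2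
      (Or.inl ⟨_, (trans_actOne_iff E hM _ _ _ _).2 ⟨rfl, rfl⟩, rfl⟩), rfl⟩) fun π h => ?_
    obtain ⟨_, h, -⟩ := (trans_padNil_iff E hM _ hb (n + 1) π).1 h
    obtain ⟨_, h, -⟩ := (trans_bang_iff E hM _ hb _).1 h
    exact hba ((trans_actOne_iff E hM _ _ _ _).1 h).1

end Transitions

/-! ### From distances to failure of uniform continuity -/

theorem exists_prob_one_sub_lt {δ : ℝ} (hδ : 0 < δ) : ∃ p : Prob, 1 - p.1 < δ := by
  -- The maximum with 0 keeps the weight positive when `δ > 1`.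
  obtain ⟨x, hx, hx1⟩ := exists_between (max_lt (sub_lt_self 1 hδ) one_pos)
  rw [max_lt_iff] at hx
  exact ⟨⟨x, hx.2, hx1⟩, by simp only; linarith [hx.1]⟩

theorem not_isUnifContOp_unary {S : Signature.{u}} {d : Proc S → Proc S → ℝ} {f : S.Op 1}
    {s : Prob → Proc S} {t : Proc S} (hst : ∀ p : Prob, d (s p) t ≤ 1 - p.1)
    (hf : ∀ p, d (.op f ![s p]) (.op f ![t]) = 1) : ¬ IsUnifContOp d f := by
  intro h
  obtain ⟨δ, hδ, h⟩ := h 1 one_pos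
  obtain ⟨p, hp⟩ := exists_prob_one_sub_lt (hδ 0)
  refine (h ![s p] ![t] fun i => ?_).ne (hf p)
  fin_cases i
  exact (hst p).trans_lt hp

/-- Freezing the second argument at `z` reduces this to the unary argument: input distances fall
below any `δ` while the output distance stays 1. -/
theorem not_isUnifContOp_binary {S : Signature.{u}} {d : Proc S → Proc S → ℝ} {f : S.Op 2}
    {s : Prob → Proc S} {t z : Proc S} (hz : d z z ≤ 0) (hst : ∀ p : Prob, d (s p) t ≤ 1 - p.1)
    (hf : ∀ p, d (.op f ![s p, z]) (.op f ![t, z]) = 1) : ¬ IsUnifContOp d f := by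
  intro h
  obtain ⟨δ, hδ, h⟩ := h 1 one_pos
  obtain ⟨p, hp⟩ := exists_prob_one_sub_lt (hδ 0)
  refine (h ![s p, z] ![t, z] fun i => ?_).ne (hf p)
  fin_cases i
  · exact (hst p).trans_lt hp
  · exact hz.trans_lt (hδ 1)

end ProbProc

/-- Let `P` be any disjoint extension of the process algebra, with supported model `M`, and let `d`
be its non-discounted bisimilarity metric. None of infinite iteration, Kleene star, probabilistic
Kleene star and bang is uniformly continuous with respect to `d`. There has to be an action `a`
other than the termination action `tick`, and for bang a second one. -/
theorem mainTheorem9 {A : Type*} (tick : A) {S : ProbProc.Signature}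
    (P : ProbProc.PTSS S A)
    (E : ProbProc.DisjointExtension (ProbProc.PA tick) P)
    (M : ProbProc.PTS S A) (hM : P.IsSupportedModel M)
    (a : A) (ha : a ≠ tick) :
    ¬ ProbProc.IsUnifContOp (ProbProc.bisimDist M 1) (E.ι ProbProc.PAOp.omega) ∧
    ¬ ProbProc.IsUnifContOp (ProbProc.bisimDist M 1) (E.ι ProbProc.PAOp.kleene) ∧
    (∀ p : ProbProc.Prob,
      ¬ ProbProc.IsUnifContOp (ProbProc.bisimDist M 1) (E.ι (ProbProc.PAOp.pkleene p))) ∧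
    ((∃ b : A, b ≠ tick ∧ b ≠ a) →
      ¬ ProbProc.IsUnifContOp (ProbProc.bisimDist M 1) (E.ι ProbProc.PAOp.bang)) ∧
    ∀ (δ : ℝ) (h0 : 0 < δ) (h2 : δ < 2) (s t : ProbProc.Proc S),
      s = (ProbProc.actSkipOrNil a
        ⟨1 - δ / 2, by linarith, by linarith⟩).mapOp (fun {_} f => E.ι f) →
      t = (ProbProc.actSkip a).mapOp (fun {_} f => E.ι f) →
      ProbProc.bisimDist M 1 s t = δ / 2 ∧
      ProbProc.bisimDist M 1 (.op (E.ι ProbProc.PAOp.omega) ![s])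
        (.op (E.ι ProbProc.PAOp.omega) ![t]) = 1 := by
  refine ⟨ProbProc.not_isUnifContOp_unary (ProbProc.bisimDist_act_le E hM a · _ _) fun p =>
      ProbProc.bisimDist_loop E hM ha p (ProbProc.isLoop_omega E hM _ ha)
        (ProbProc.isLoop_omega E hM _ ha),
    ProbProc.not_isUnifContOp_binary (ProbProc.bisimDist_self_le _)
      (ProbProc.bisimDist_act_le E hM a · _ _) fun p =>
      ProbProc.bisimDist_loop E hM ha p (ProbProc.isLoop_kleene E hM _ ha)
        (ProbProc.isLoop_kleene E hM _ ha),
    fun q => ProbProc.not_isUnifContOp_binary (ProbProc.bisimDist_self_le _)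
      (ProbProc.bisimDist_act_le E hM a · _ _) fun p =>
      ProbProc.bisimDist_loop E hM ha p (ProbProc.isLoop_pkleene E hM q _ ha)
        (ProbProc.isLoop_pkleene E hM q _ ha),
    ?_, ?_⟩
  · rintro ⟨b, hb, hba⟩
    exact ProbProc.not_isUnifContOp_unary (ProbProc.bisimDist_act_le E hM a · _ _) fun p =>
      ProbProc.bisimDist_bang E hM ha hb hba p
  · rintro δ h0 h2 s t rfl rfl
    rw [ProbProc.actSkip_mapOp, ProbProc.actSkipOrNil_mapOp]
    -- Here `p = 1 - δ / 2`, so `1 - p = δ / 2`.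
    refine ⟨(ProbProc.bisimDist_act_skip_nil E hM a _).trans (by simp only; ring), ?_⟩
    exact ProbProc.bisimDist_loop E hM ha _ (ProbProc.isLoop_omega E hM _ ha)
      (ProbProc.isLoop_omega E hM _ ha)
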